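/- Let $$S_4=\{(r,r),(r,-r),(2r,0)\mid r\ge 1\},\quad S_5=\{(1,1),(1,-1),(2r,0)\mid r\ge 1\},\quad S_6=\{(r,r),(r,-r),(2,0)\mid r\ge 1\},$$ with $r$ ranging over positive integers. For a step set $S$, let $L_S(n)$ be the set of lattice paths (sequences of steps) from $(0,0)$ to $(2n,0)$ with steps in $S$ that never go below the $x$-axis, and let $A_S(n)\subseteq L_S(n)$ be the subset of those paths that have no horizontal step (a step $(k,0)$) on the $x$-axis. Let $f_1(x)=1-12x+16x^2$, $f_2(x)=1-8x+12x^2-4x^3$ and $f_3(x)=(1-x)(1-11x+7x^2-x^3)$. Each $f_i$ has a real root $\alpha_i$ such that every other complex root of $f_i$ has strictly larger modulus; here $\alpha_1=\frac{3-\sqrt5}{8}$, $\alpha_2=0.16243\cdots$ and $\alpha_3=0.09678\cdots$. Moreover $$\lim_{n\to\infty}\frac{|L_{S_4}(n)|}{|A_{S_4}(n)|}=\frac{5(1-\alpha_1)^2}{(2-3\alpha_1)^2}=1.39320\cdots,$$ $$\lim_{n\to\infty}\frac{|L_{S_5}(n)|}{|A_{S_5}(n)|}=\frac{2-\alpha_2}{1-\alpha_2}=2.19393\cdots,$$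 $$\lim_{n\to\infty}\frac{|L_{S_6}(n)|}{|A_{S_6}(n)|}=\frac{5-\alpha_3}{(2-\alpha_3)^2}=1.35364\cdots.$$ In each case "$\cdots$" means that the displayed digits are the leading digits of the (truncated) decimal expansion. -/

import Mathlib

open Filter Topology

namespace SchroederPaths

/-- A lattice path starting at the origin, given by its list of steps in `ℤ × ℤ`. -/
abbrev LatticePath : Type := List (ℤ × ℤ)

/-- The step set `S₄ = {(r, r), (r, -r), (2r, 0) | r ≥ 1}`. -/
def S4 : Set (ℤ × ℤ) :=
  {s | ∃ r : ℤ, 1 ≤ r ∧ (s = (r, r) ∨ s = (r, -r) ∨ s = (2 * r, 0))}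

/-- The step set `S₅ = {(1, 1), (1, -1), (2r, 0) | r ≥ 1}`. -/
def S5 : Set (ℤ × ℤ) :=
  {s | s = (1, 1) ∨ s = (1, -1) ∨ ∃ r : ℤ, 1 ≤ r ∧ s = (2 * r, 0)}

/-- The step set `S₆ = {(r, r), (r, -r), (2, 0) | r ≥ 1}`. -/
def S6 : Set (ℤ × ℤ) :=
  {s | (∃ r : ℤ, 1 ≤ r ∧ (s = (r, r) ∨ s = (r, -r))) ∨ s = (2, 0)}

/-- `L S n`: the lattice paths from `(0, 0)` to `(2n, 0)` with steps in `S` that never go below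
the `x`-axis.  The sum of a prefix of the list of steps is the vertex reached after that prefix;
since steps are straight segments, it is enough that no vertex lies below the axis. -/
def L (S : Set (ℤ × ℤ)) (n : ℕ) : Set LatticePath :=
  {p | (∀ s ∈ p, s ∈ S) ∧ p.sum = (2 * (n : ℤ), 0) ∧
    ∀ q : LatticePath, q <+: p → 0 ≤ q.sum.2}

/-- `A S n`: the paths in `L S n` with no horizontal step on the `x`-axis, i.e. no step `s` with
zero vertical component starts at a vertex at height zero. -/
def A (S : Set (ℤ × ℤ)) (n : ℕ) : Set LatticePath :=
  {p | p ∈ L S n ∧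
    ∀ (q : LatticePath) (s : ℤ × ℤ), (q ++ [s]) <+: p → s.2 = 0 → q.sum.2 ≠ 0}

/-- `f₁(x) = 1 - 12x + 16x²`. -/
def f1 {R : Type*} [CommRing R] (x : R) : R := 1 - 12 * x + 16 * x ^ 2

/-- `f₂(x) = 1 - 8x + 12x² - 4x³`. -/
def f2 {R : Type*} [CommRing R] (x : R) : R := 1 - 8 * x + 12 * x ^ 2 - 4 * x ^ 3

/-- `f₃(x) = (1 - x)(1 - 11x + 7x² - x³)`. -/
def f3 {R : Type*} [CommRing R] (x : R) : R := (1 - x) * (1 - 11 * x + 7 * x ^ 2 - x ^ 3)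

/-- The real number `α` is the root of smallest modulus of `f : ℂ → ℂ`: it is a zero of `f`, and
every other complex zero of `f` has strictly larger modulus.  At most one `α` has this property. -/
def IsDominantRoot (f : ℂ → ℂ) (α : ℝ) : Prop :=
  f (α : ℂ) = 0 ∧ ∀ z : ℂ, f z = 0 → z ≠ (α : ℂ) → ‖(α : ℂ)‖ < ‖z‖

end SchroederPaths

namespace SchroederPaths

open PowerSeries

/-! Counting. Splitting off the first step gives a recursion in the starting height `h`
(`ncard_pathsFrom`). It is solved by series geometric in `h`: `E * M ^ h` for unit diagonals
(`ncard_flat`) and `E * (Y - 1) * Y ^ h` for diagonals of all lengths (`ncard_steep`). What remains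
is one quadratic, for `M` or for the series `P` of arches, i.e. excursions that meet the axis only
at their two ends. Up to a square factor, its discriminant is `f1`, `f2` or `f3`. With `H` the
series of horizontal steps, the steep counts are `1 / (1 - P)` for `A` and `1 / (1 - P - H)` for
`L`; the flat ones are `1 / (1 - X * M)` and `M`. Multiplying by the conjugate turns each into
(polynomial + polynomial · √f), divided by `X` and by constants or affine factors whose zeros lie
beyond the dominant root `α`.

Asymptotics. All other roots of `f` are real as well, so √f is √(1 - x/α) times real factors √(1 -
γx) with |γ|α < 1. The coefficients of √(1 - x/α) serve as the reference sequence; their successive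
quotients tend to `α`. By `CoeffAsymp.mul_left`, a factor with larger radius of convergence acts on
the asymptotic constant through its value at `α`; division by `X` or by an affine factor acts
likewise. The constant of √f is never computed: it is nonzero, and it cancels in the quotient of the
two counts. -/

/-! ### Coefficient asymptotics relative to a reference sequence -/

/-- The coefficients of `F` are asymptotically `m` times the reference sequence `c`. -/
def CoeffAsymp (c : ℕ → ℝ) (F : ℝ⟦X⟧) (m : ℝ) : Prop :=
  Tendsto (fun n => coeff n F / c n) atTop (𝓝 m)

/-- A nowhere vanishing sequence whose successive quotients `c n / c (n + 1)` tend to `α`. -/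
structure RatioSeq (c : ℕ → ℝ) (α : ℝ) : Prop where
  pos : 0 < α
  ne_zero : ∀ n, c n ≠ 0
  tendsto : Tendsto (fun n => c n / c (n + 1)) atTop (𝓝 α)

section asymptotics

variable {c : ℕ → ℝ} {α : ℝ} {F G : ℝ⟦X⟧} {m m' : ℝ}

theorem CoeffAsymp.add (hF : CoeffAsymp c F m) (hG : CoeffAsymp c G m') :
    CoeffAsymp c (F + G) (m + m') := by
  have := Tendsto.add hF hG
  refine this.congr fun n => ?_
  rw [map_add, add_div]

theorem CoeffAsymp.C_mul (a : ℝ) (hF : CoeffAsymp c F m) : CoeffAsymp c (C a * F) (a * m) := by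
  refine (Tendsto.const_mul a hF).congr fun n => ?_
  rw [coeff_C_mul, mul_div_assoc]

theorem coeffAsymp_one (c : ℕ → ℝ) : CoeffAsymp c 1 0 := by
  refine tendsto_const_nhds.congr' ?_
  filter_upwards [eventually_ne_atTop 0] with n hn
  simp [coeff_one, hn]

theorem CoeffAsymp.of_X_mul (hc : RatioSeq c α) (hF : CoeffAsymp c (X * F) m) :
    CoeffAsymp c F (m / α) := by
  have h1 : Tendsto (fun n => coeff (n + 1) (X * F) / c (n + 1)) atTop (𝓝 m) :=
    (tendsto_add_atTop_iff_nat 1).2 hF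
  refine (h1.div hc.tendsto hc.pos.ne').congr fun n => ?_
  have := hc.ne_zero n
  have := hc.ne_zero (n + 1)
  simp only [Pi.div_apply, coeff_succ_X_mul]
  field_simp

theorem CoeffAsymp.tendsto_ratio (hc : RatioSeq c α) (hF : CoeffAsymp c F m)
    (hG : CoeffAsymp c G m') (hm : m' ≠ 0) :
    Tendsto (fun n => coeff n F / coeff n G) atTop (𝓝 (m / m')) := by
  refine (Tendsto.div hF hG hm).congr fun n => ?_
  have := hc.ne_zero n
  simp only [Pi.div_apply]
  rw [div_div_div_cancel_right₀ this]

/-- Since the quotients tend to `α < ρ`, the sequence `|c n| * ρ ^ n` is eventually nondecreasing;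
the constant `K` absorbs the finitely many exceptions. This supplies the domination in
`CoeffAsymp.mul_left`. -/
theorem RatioSeq.exists_bound (hc : RatioSeq c α) {ρ : ℝ} (hρ : α < ρ) :
    ∃ K : ℝ, ∀ i j, i ≤ j → |c i| * ρ ^ i ≤ K * (|c j| * ρ ^ j) := by
  have hρ0 : 0 < ρ := hc.pos.trans hρ
  have hu : ∀ n, 0 < |c n| * ρ ^ n := fun n => mul_pos (abs_pos.2 (hc.ne_zero n)) (pow_pos hρ0 n)
  obtain ⟨N, hN⟩ : ∃ N, ∀ n ≥ N, |c n| * ρ ^ n ≤ |c (n + 1)| * ρ ^ (n + 1) := by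
    have h1 := hc.tendsto.abs
    rw [abs_of_pos hc.pos] at h1
    obtain ⟨N, hN⟩ := eventually_atTop.1 (h1.eventually_le_const hρ)
    refine ⟨N, fun n hn => ?_⟩
    have h2 := hN n hn
    rw [abs_div, div_le_iff₀ (abs_pos.2 (hc.ne_zero (n + 1)))] at h2
    calc |c n| * ρ ^ n ≤ (ρ * |c (n + 1)|) * ρ ^ n := by gcongr
      _ = _ := by ring
  have hmono : ∀ i j, N ≤ i → i ≤ j → |c i| * ρ ^ i ≤ |c j| * ρ ^ j := by
    intro i j hi hij
    induction j, hij using Nat.le_induction with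
    | base => exact le_rfl
    | succ j hj ih => exact ih.trans (hN j (hi.trans hj))
  -- `K` is the ratio of the largest to the smallest value on `0, …, N`. By monotonicity after `N`,
  -- that smallest value is a lower bound for the whole sequence.
  obtain ⟨a, ha, hamin⟩ := Finset.exists_min_image (Finset.range (N + 1))
    (fun n => |c n| * ρ ^ n) ⟨0, by simp⟩
  obtain ⟨b, hb, hbmax⟩ := Finset.exists_max_image (Finset.range (N + 1))
    (fun n => |c n| * ρ ^ n) ⟨0, by simp⟩
  have hab := hamin b hb
  have hlow : ∀ j, |c a| * ρ ^ a ≤ |c j| * ρ ^ j := by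
    intro j
    rcases le_or_gt j N with hj | hj
    · exact hamin j (Finset.mem_range.2 (by omega))
    · exact (hamin N (by simp)).trans (hmono N j le_rfl hj.le)
  have hK : 1 ≤ (|c b| * ρ ^ b) / (|c a| * ρ ^ a) := (one_le_div (hu a)).2 hab
  refine ⟨(|c b| * ρ ^ b) / (|c a| * ρ ^ a), fun i j hij => ?_⟩
  rcases le_or_gt i N with hi | hi
  · calc |c i| * ρ ^ i ≤ |c b| * ρ ^ b := hbmax i (Finset.mem_range.2 (by omega))
      _ = (|c b| * ρ ^ b) / (|c a| * ρ ^ a) * (|c a| * ρ ^ a) := by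
        rw [div_mul_cancel₀ _ (hu a).ne']
      _ ≤ _ := by
        have := hlow j
        gcongr
  · calc |c i| * ρ ^ i ≤ 1 * (|c j| * ρ ^ j) := by rw [one_mul]; exact hmono i j hi.le hij
      _ ≤ _ := by
        have := (hu j).le
        gcongr

/-- Multiplication by a series of larger radius of convergence multiplies the asymptotic constant
by the value at `α`. -/
theorem CoeffAsymp.mul_left (hc : RatioSeq c α) (hF : CoeffAsymp c F m) {ρ : ℝ} (hρ : α < ρ)
    (hG : Summable fun k => |coeff k G| * ρ ^ k) :
    CoeffAsymp c (G * F) ((∑' k, coeff k G * α ^ k) * m) := by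
  have hρ0 : 0 < ρ := hc.pos.trans hρ
  obtain ⟨K, hK⟩ := hc.exists_bound hρ
  obtain ⟨M, hM⟩ := (hF.abs).bddAbove_range
  have hM' : ∀ n, |coeff n F| ≤ M * |c n| := fun n => by
    have h : |coeff n F / c n| ≤ M := hM ⟨n, rfl⟩
    rwa [abs_div, div_le_iff₀ (abs_pos.2 (hc.ne_zero n))] at h
  have hM0 : 0 ≤ M := (abs_nonneg _).trans (hM ⟨0, rfl⟩)
  -- Telescoping: a shift by `k` is a product of `k` successive quotients. Truncated subtraction
  -- only affects `n < k`.
  have hshift : ∀ k, Tendsto (fun n => c (n - k) / c n) atTop (𝓝 (α ^ k)) := by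
    intro k
    induction k with
    | zero =>
      simp only [Nat.sub_zero, pow_zero]
      exact tendsto_const_nhds.congr fun n => (div_self (hc.ne_zero n)).symm
    | succ k ih =>
      have h1 : Tendsto (fun n => c (n - (k + 1)) / c (n - (k + 1) + 1)) atTop (𝓝 α) :=
        hc.tendsto.comp (tendsto_sub_atTop_nat (k + 1))
      rw [pow_succ']
      refine (h1.mul ih).congr' ?_
      filter_upwards [eventually_ge_atTop (k + 1)] with n hn
      rw [show n - (k + 1) + 1 = n - k by omega]
      have := hc.ne_zero n
      have := hc.ne_zero (n - k)
      field_simp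
  rw [← tsum_mul_right]
  -- Tannery's theorem for the Cauchy product divided by `c n`, with the terms `k > n` set to zero.
  -- The `k`-th term tends to `coeff k G * α ^ k * m` and is dominated by a multiple of `|coeff k G|
  -- * ρ ^ k`.
  have key := tendsto_tsum_of_dominated_convergence (𝓕 := atTop)
    (f := fun n k => if k ≤ n then coeff k G * coeff (n - k) F / c n else 0)
    (g := fun k => coeff k G * α ^ k * m)
    (bound := fun k => (|coeff k G| * ρ ^ k) * (M * K)) (hG.mul_right _) ?_ ?_
  · refine key.congr fun n => ?_
    rw [tsum_eq_sum (s := Finset.range (n + 1))]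
    · rw [coeff_mul, Finset.Nat.sum_antidiagonal_eq_sum_range_succ_mk, Finset.sum_div]
      refine Finset.sum_congr rfl fun k hk => ?_
      rw [if_pos (by simpa [Nat.lt_succ_iff] using hk)]
    · intro k hk
      rw [if_neg (by simpa [Nat.lt_succ_iff] using hk)]
  · intro k
    have h1 : Tendsto (fun n => coeff (n - k) F / c (n - k)) atTop (𝓝 m) :=
      Tendsto.comp hF (tendsto_sub_atTop_nat k)
    refine (((hshift k).const_mul (coeff k G)).mul h1).congr' ?_
    filter_upwards [eventually_ge_atTop k] with n hn
    rw [if_pos hn]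
    have := hc.ne_zero n
    have := hc.ne_zero (n - k)
    field_simp
  · refine Eventually.of_forall fun n k => ?_
    split_ifs with hkn
    · have hcn := abs_pos.2 (hc.ne_zero n)
      have hb := hK (n - k) n (Nat.sub_le _ _)
      have hb' : |c (n - k)| ≤ K * |c n| * ρ ^ k := by
        have hp : ρ ^ n = ρ ^ k * ρ ^ (n - k) := by rw [← pow_add]; congr 1; omega
        rw [hp] at hb
        refine le_of_mul_le_mul_right (hb.trans_eq ?_) (pow_pos hρ0 (n - k))
        ring
      rw [Real.norm_eq_abs, abs_div, abs_mul, div_le_iff₀ hcn]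
      calc |coeff k G| * |coeff (n - k) F|
          ≤ |coeff k G| * (M * (K * |c n| * ρ ^ k)) := by
            gcongr
            exact (hM' _).trans (by gcongr)
        _ = _ := by ring
    · have h0 : 0 ≤ K := by
        have h2 : 0 < |c 0| * ρ ^ 0 := by simpa using hc.ne_zero 0
        have := (hK 0 0 le_rfl)
        nlinarith
      rw [norm_zero]
      positivity

theorem exists_between_of_abs_mul_lt_one {γ : ℝ} (h : |γ| * α < 1) :
    ∃ ρ, α < ρ ∧ |γ| * ρ < 1 := by
  rcases eq_or_ne γ 0 with rfl | hγ
  · exact ⟨α + 1, by linarith, by simp⟩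
  · have hg := abs_pos.2 hγ
    obtain ⟨ρ, h1, h2⟩ := exists_between ((lt_div_iff₀' hg).2 h)
    exact ⟨ρ, h1, (lt_div_iff₀' hg).1 h2⟩

theorem summable_abs_coeff_of_le {γ ρ : ℝ} (hρ : 0 ≤ ρ) (h : |γ| * ρ < 1)
    (hG : ∀ k, |coeff k G| ≤ |γ| ^ k) : Summable fun k => |coeff k G| * ρ ^ k := by
  refine Summable.of_nonneg_of_le (fun k => by positivity) (fun k => ?_)
    (summable_geometric_of_lt_one (mul_nonneg (abs_nonneg γ) hρ) h)
  rw [mul_pow]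
  have := hG k
  gcongr

/-- Division by `1 - γ X` with `γ⁻¹` outside the closed disc of radius `α`. -/
theorem CoeffAsymp.of_linear_mul (hc : RatioSeq c α) {γ : ℝ} (h : |γ| * α < 1)
    (hF : CoeffAsymp c ((1 - C γ * X) * F) m) : CoeffAsymp c F (m / (1 - γ * α)) := by
  obtain ⟨ρ, hρ, hγρ⟩ := exists_between_of_abs_mul_lt_one h
  have hinv : (mk fun n => γ ^ n) * (1 - C γ * X) = (1 : ℝ⟦X⟧) := by
    ext n
    rw [mul_sub, mul_one, ← mul_assoc, map_sub]
    cases n with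
    | zero => simp [coeff_zero_eq_constantCoeff_apply]
    | succ n =>
      rw [coeff_succ_mul_X, mul_comm, coeff_C_mul, coeff_mk, coeff_mk]
      simp [coeff_one, pow_succ']
  have hs : Summable fun k => |coeff k (mk fun n => γ ^ n : ℝ⟦X⟧)| * ρ ^ k :=
    summable_abs_coeff_of_le (hc.pos.trans hρ).le hγρ fun k => by simp [abs_pow]
  have := hF.mul_left hc hρ hs
  rw [← mul_assoc, hinv, one_mul] at this
  have hlt : ‖γ * α‖ < 1 := by rwa [Real.norm_eq_abs, abs_mul, abs_of_pos hc.pos]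
  have ht : ∑' k, coeff k (mk fun n => γ ^ n : ℝ⟦X⟧) * α ^ k = (1 - γ * α)⁻¹ := by
    simp only [coeff_mk, ← mul_pow]
    exact tsum_geometric_of_norm_lt_one hlt
  rwa [ht, inv_mul_eq_div] at this

end asymptotics

/-! ### Square roots of linear factors -/

/-- The power series of `√(1 - γ x)`. -/
noncomputable def sqrtSeries (γ : ℝ) : ℝ⟦X⟧ := rescale (-γ) (PowerSeries.binomialSeries ℝ (1 / 2 : ℝ))

theorem coeff_sqrtSeries (γ : ℝ) (n : ℕ) :
    coeff n (sqrtSeries γ) = (-γ) ^ n * Ring.choose (1 / 2 : ℝ) n := by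
  rw [sqrtSeries, coeff_rescale, binomialSeries_coeff, smul_eq_mul, mul_one]

theorem sqrtSeries_mul_self (γ : ℝ) : sqrtSeries γ * sqrtSeries γ = 1 - C γ * X := by
  have h1 : PowerSeries.binomialSeries ℝ ((1 : ℕ) : ℝ) = (1 + X : ℝ⟦X⟧) ^ 1 := binomialSeries_nat 1
  rw [sqrtSeries, ← map_mul, ← binomialSeries_add, show (1 / 2 + 1 / 2 : ℝ) = ((1 : ℕ) : ℝ) by
    norm_num, h1, pow_one, map_add, map_one, rescale_X, map_neg, neg_mul, sub_eq_add_neg]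

theorem constantCoeff_sqrtSeries (γ : ℝ) : constantCoeff (sqrtSeries γ) = 1 := by
  rw [← coeff_zero_eq_constantCoeff_apply, coeff_sqrtSeries]
  simp

theorem choose_half_succ (n : ℕ) : ((n : ℝ) + 1) * Ring.choose (1 / 2 : ℝ) (n + 1) =
    Ring.choose (1 / 2 : ℝ) n * (1 / 2 - n) := by
  have := Ring.choose_smul_choose (1 / 2 : ℝ) (Nat.le_succ n)
  simpa using this

theorem choose_half_ne_zero (n : ℕ) : Ring.choose (1 / 2 : ℝ) n ≠ 0 := by
  induction n with
  | zero => simp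
  | succ n ih =>
    intro h
    have h1 := choose_half_succ n
    rw [h, mul_zero] at h1
    rcases mul_eq_zero.1 h1.symm with h2 | h2
    · exact ih h2
    · have h3 : (2 * n : ℝ) = 1 := by linarith
      have h4 : 2 * n = 1 := by exact_mod_cast h3
      omega

theorem abs_choose_half_le (n : ℕ) : |Ring.choose (1 / 2 : ℝ) n| ≤ 1 := by
  induction n with
  | zero => simp
  | succ n ih =>
    have h1 := congrArg abs (choose_half_succ n)
    have hn : (0 : ℝ) ≤ n := n.cast_nonneg
    rw [abs_mul, abs_mul, abs_of_pos (by positivity : (0 : ℝ) < n + 1)] at h1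
    have h2 : |(1 / 2 - n : ℝ)| ≤ n + 1 := by rw [abs_le]; constructor <;> linarith
    have h3 := mul_le_mul ih h2 (abs_nonneg _) zero_le_one
    refine le_of_mul_le_mul_left (a := (n : ℝ) + 1) ?_ (by positivity)
    linarith

/-- By the recurrence for binomial coefficients, the quotient of successive coefficients is `γ⁻¹ *
(n + 1) / (n - 1 / 2)`. -/
theorem ratioSeq_sqrtSeries {γ : ℝ} (hγ : 0 < γ) :
    RatioSeq (fun n => coeff n (sqrtSeries γ)) γ⁻¹ := by
  have hne : ∀ n, coeff n (sqrtSeries γ) ≠ 0 := fun n => by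
    rw [coeff_sqrtSeries]
    exact mul_ne_zero (pow_ne_zero _ (neg_ne_zero.2 hγ.ne')) (choose_half_ne_zero n)
  refine ⟨inv_pos.2 hγ, hne, ?_⟩
  have h1 : Tendsto (fun n : ℕ => γ⁻¹ * (((n : ℝ) + 1) / ((n : ℝ) + (-(1 / 2))))) atTop
      (𝓝 (γ⁻¹ * 1)) := by
    refine Tendsto.const_mul _ ?_
    have h2 : Tendsto (fun n : ℕ => 1 + (3 / 2) / ((n : ℝ) + (-(1 / 2)))) atTop (𝓝 (1 + 0)) :=
      tendsto_const_nhds.add (Tendsto.const_div_atTop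
        (tendsto_atTop_add_const_right _ _ tendsto_natCast_atTop_atTop) _)
    rw [add_zero] at h2
    refine h2.congr' ?_
    filter_upwards [eventually_ge_atTop 1] with n hn
    have : (1 : ℝ) ≤ n := by exact_mod_cast hn
    have : (n : ℝ) + (-(1 / 2)) ≠ 0 := by linarith
    rw [one_add_div this]
    congr 1
    ring
  rw [mul_one] at h1
  refine h1.congr' ?_
  filter_upwards [eventually_ge_atTop 1] with n hn
  have h3 : (1 : ℝ) ≤ n := by exact_mod_cast hn
  have h4 : (n : ℝ) + (-(1 / 2)) ≠ 0 := by linarith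
  rw [eq_div_iff (hne _), coeff_sqrtSeries, coeff_sqrtSeries]
  have h5 := choose_half_succ n
  rw [show (1 / 2 - n : ℝ) = -((n : ℝ) + (-(1 / 2))) by ring] at h5
  generalize (n : ℝ) + (-(1 / 2)) = d at h4 h5 ⊢
  rw [pow_succ]
  field_simp
  linear_combination -(-γ) ^ n * h5

/-- The multiplier is the value of the series at `α`. Its square is `1 - γ * α > 0`, so it cannot
vanish; its exact value is not needed later. -/
theorem CoeffAsymp.sqrtSeries_mul {c : ℕ → ℝ} {α : ℝ} {F : ℝ⟦X⟧} {m : ℝ} (hc : RatioSeq c α)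
    {γ : ℝ} (h : |γ| * α < 1) (hF : CoeffAsymp c F m) (hm : m ≠ 0) :
    ∃ m' ≠ 0, CoeffAsymp c (sqrtSeries γ * F) m' := by
  obtain ⟨ρ, hρ, hγρ⟩ := exists_between_of_abs_mul_lt_one h
  have hle : ∀ k, |coeff k (sqrtSeries γ)| ≤ |γ| ^ k := fun k => by
    rw [coeff_sqrtSeries, abs_mul, abs_pow, abs_neg]
    exact mul_le_of_le_one_right (by positivity) (abs_choose_half_le k)
  refine ⟨_, mul_ne_zero ?_ hm, hF.mul_left hc hρ
    (summable_abs_coeff_of_le (hc.pos.trans hρ).le hγρ hle)⟩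
  -- If the value were zero, the Cauchy square of the absolutely convergent series would give `1 - γ
  -- * α = 0`.
  intro h0
  have hs : Summable fun k => ‖coeff k (sqrtSeries γ) * α ^ k‖ := by
    refine (summable_abs_coeff_of_le hc.pos.le h hle).congr fun k => ?_
    rw [Real.norm_eq_abs, abs_mul, abs_of_pos (pow_pos hc.pos k)]
  have h1 := tsum_mul_tsum_eq_tsum_sum_antidiagonal_of_summable_norm hs hs
  rw [h0, zero_mul] at h1
  have h2 : ∀ n, ∑ kl ∈ Finset.HasAntidiagonal.antidiagonal n, coeff kl.1 (sqrtSeries γ) * α ^ kl.1 *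
      (coeff kl.2 (sqrtSeries γ) * α ^ kl.2) = coeff n (1 - C γ * X : ℝ⟦X⟧) * α ^ n := by
    intro n
    rw [← sqrtSeries_mul_self, coeff_mul, Finset.sum_mul]
    refine Finset.sum_congr rfl fun kl hkl => ?_
    rw [← Finset.HasAntidiagonal.mem_antidiagonal.1 hkl, pow_add]
    ring
  simp only [h2] at h1
  rw [tsum_eq_sum (s := Finset.range 2)] at h1
  · simp [Finset.sum_range_succ, coeff_one, coeff_X] at h1
    have h3 := le_abs_self γ
    have := hc.pos
    nlinarith
  · intro n hn
    have : n ≠ 0 ∧ n ≠ 1 := by simp at hn; omega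
    simp [coeff_one, coeff_X, this.1, this.2]

/-! ### First-step decomposition of paths -/

/-- The steps `(r, r)`, `(r, -r)` with `u (r - 1)` and `(2r, 0)` with `v (r - 1)`, for `r ≥ 1`. -/
def stepSet (u v : ℕ → Prop) : Set (ℤ × ℤ) :=
  {s | ∃ r : ℕ, (u r ∧ (s = ((r : ℤ) + 1, (r : ℤ) + 1) ∨ s = ((r : ℤ) + 1, -((r : ℤ) + 1)))) ∨
    (v r ∧ s = (2 * ((r : ℤ) + 1), 0))}

/-- The nonnegative paths from height `h` to height `0` of width `2k + h`; horizontal steps on the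
axis are allowed only if `b` holds. -/
def pathsFrom (S : Set (ℤ × ℤ)) (b : Prop) (h k : ℕ) : Set LatticePath :=
  {p | (∀ s ∈ p, s ∈ S) ∧ p.sum = (2 * (k : ℤ) + h, -(h : ℤ)) ∧
    (∀ q : LatticePath, q <+: p → 0 ≤ (h : ℤ) + q.sum.2) ∧
    (b ∨ ∀ (q : LatticePath) (s : ℤ × ℤ), (q ++ [s]) <+: p → s.2 = 0 → (h : ℤ) + q.sum.2 ≠ 0)}

theorem L_eq_pathsFrom (S : Set (ℤ × ℤ)) (n : ℕ) : L S n = pathsFrom S True 0 n := by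
  ext p
  simp [L, pathsFrom]

theorem A_eq_pathsFrom (S : Set (ℤ × ℤ)) (n : ℕ) : A S n = pathsFrom S False 0 n := by
  ext p
  simp [A, L, pathsFrom, and_assoc]

theorem nil_mem_pathsFrom {S : Set (ℤ × ℤ)} {b : Prop} {h k : ℕ} :
    [] ∈ pathsFrom S b h k ↔ h = 0 ∧ k = 0 := by
  constructor
  · rintro ⟨-, h1, -⟩
    have h2 := congrArg Prod.snd h1
    have h3 := congrArg Prod.fst h1
    simp at h2 h3
    omega
  · rintro ⟨rfl, rfl⟩
    simp [pathsFrom]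
    rfl

theorem cons_mem_pathsFrom {S : Set (ℤ × ℤ)} {b : Prop} {h k h' k' : ℕ} {s : ℤ × ℤ}
    {p : LatticePath} (h2 : (h : ℤ) + s.2 = h') (h1 : 2 * (k : ℤ) + h - s.1 = 2 * k' + h') :
    s :: p ∈ pathsFrom S b h k ↔
      s ∈ S ∧ (b ∨ (s.2 = 0 → h ≠ 0)) ∧ p ∈ pathsFrom S b h' k' := by
  have hsum : (s :: p).sum = (2 * (k : ℤ) + h, -(h : ℤ)) ↔
      p.sum = (2 * (k' : ℤ) + h', -(h' : ℤ)) := by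
    rw [List.sum_cons, Prod.ext_iff, Prod.ext_iff]
    simp only [Prod.fst_add, Prod.snd_add]
    constructor <;> rintro ⟨ha, hb⟩ <;> constructor <;> linarith
  have hpre : (∀ q : LatticePath, q <+: s :: p → 0 ≤ (h : ℤ) + q.sum.2) ↔
      ∀ q : LatticePath, q <+: p → 0 ≤ (h' : ℤ) + q.sum.2 := by
    constructor
    · intro H q hq
      have := H (s :: q) (List.cons_prefix_cons.2 ⟨rfl, hq⟩)
      rw [List.sum_cons, Prod.snd_add] at this
      linarith
    · intro H q hq
      rcases List.prefix_cons_iff.1 hq with rfl | ⟨t, rfl, ht⟩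
      · simp
      · have := H t ht
        rw [List.sum_cons, Prod.snd_add]
        linarith
  have haxis : (∀ (q : LatticePath) (t : ℤ × ℤ), (q ++ [t]) <+: s :: p → t.2 = 0 →
      (h : ℤ) + q.sum.2 ≠ 0) ↔ (s.2 = 0 → h ≠ 0) ∧
      ∀ (q : LatticePath) (t : ℤ × ℤ), (q ++ [t]) <+: p → t.2 = 0 → (h' : ℤ) + q.sum.2 ≠ 0 := by
    constructor
    · intro H
      refine ⟨fun hs => ?_, fun q t hq ht => ?_⟩
      · have := H [] s (by simp) hs
        simpa using this
      · have := H (s :: q) t (List.cons_prefix_cons.2 ⟨rfl, hq⟩) ht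
        rw [List.sum_cons, Prod.snd_add] at this
        intro h0
        exact this (by linarith)
    · rintro ⟨H1, H2⟩ q t hq ht
      cases q with
      | nil =>
        have hts : t = s := by simpa using hq
        subst hts
        simpa using H1 ht
      | cons a q =>
        obtain ⟨rfl, hq'⟩ := List.cons_prefix_cons.1 hq
        have := H2 q t hq' ht
        rw [List.sum_cons, Prod.snd_add]
        intro h0
        exact this (by linarith)
  simp only [pathsFrom, Set.mem_ofPred_eq, List.forall_mem_cons, hsum, hpre, haxis]
  tauto

/-- No step descends by more than its width. Hence the part of a path after its first step is at
least as wide as the descent it still has to make, which bounds the length of a possible first step.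
-/
theorem sum_fst_add_snd_nonneg {u v : ℕ → Prop} {p : LatticePath}
    (hp : ∀ s ∈ p, s ∈ stepSet u v) : 0 ≤ p.sum.1 + p.sum.2 := by
  induction p with
  | nil => simp
  | cons s p ih =>
    rw [List.forall_mem_cons] at hp
    have h1 := ih hp.2
    have h2 : 0 ≤ s.1 + s.2 := by
      obtain ⟨r, ⟨-, rfl | rfl⟩ | ⟨-, rfl⟩⟩ := hp.1 <;> simp <;> omega
    rw [List.sum_cons, Prod.fst_add, Prod.snd_add]
    linarith

/-- The first steps available from height `h` with remaining half-excess width `k`: up steps,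
down steps and horizontal steps. -/
def firstStep : ℕ ⊕ ℕ ⊕ ℕ → ℤ × ℤ
  | .inl r => ((r : ℤ) + 1, (r : ℤ) + 1)
  | .inr (.inl r) => ((r : ℤ) + 1, -((r : ℤ) + 1))
  | .inr (.inr r) => (2 * ((r : ℤ) + 1), 0)

theorem firstStep_injective : Function.Injective firstStep := by
  rintro (a | a | a) (c | c | c) h <;> simp [firstStep] at h ⊢ <;> omega

open Classical in
/-- The index set of the first steps of paths in `pathsFrom (stepSet u v) b h k`. -/
noncomputable def firstSteps (u v : ℕ → Prop) (b : Prop) (h k : ℕ) : Finset (ℕ ⊕ ℕ ⊕ ℕ) :=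
  ((Finset.range k).filter u).disjSum (((Finset.range h).filter u).disjSum
    ((Finset.range k).filter fun r => v r ∧ (b ∨ h ≠ 0)))

/-- The paths that may follow a given first step. -/
def restPaths (S : Set (ℤ × ℤ)) (b : Prop) (h k : ℕ) : ℕ ⊕ ℕ ⊕ ℕ → Set LatticePath
  | .inl r => pathsFrom S b (h + r + 1) (k - r - 1)
  | .inr (.inl r) => pathsFrom S b (h - r - 1) k
  | .inr (.inr r) => pathsFrom S b h (k - r - 1)

theorem cons_mem_pathsFrom_iff {u v : ℕ → Prop} {b : Prop} {h k : ℕ} {s : ℤ × ℤ}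
    {p : LatticePath} : s :: p ∈ pathsFrom (stepSet u v) b h k ↔
      ∃ i ∈ firstSteps u v b h k, s = firstStep i ∧ p ∈ restPaths (stepSet u v) b h k i := by
  constructor
  · intro hp
    obtain ⟨hS, hsum, hpre, -⟩ := id hp
    rw [List.forall_mem_cons] at hS
    have hw := sum_fst_add_snd_nonneg hS.2
    have hs := hpre [s] (by simp)
    rw [List.sum_cons, Prod.ext_iff] at hsum
    simp only [Prod.fst_add, Prod.snd_add] at hsum
    simp only [List.sum_cons, List.sum_nil, add_zero] at hs
    obtain ⟨r, ⟨hu, rfl | rfl⟩ | ⟨hv, rfl⟩⟩ := hS.1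
    · simp only at hsum hs
      -- After this up step the remaining width is `2k + h - (r + 1)` and the remaining descent `h +
      -- r + 1`, so `hw` forces `r + 1 ≤ k`.
      have hrk : r < k := by omega
      refine ⟨.inl r, by simp [firstSteps, hrk, hu], rfl, ?_⟩
      exact ((cons_mem_pathsFrom (by push_cast; ring) (by push_cast; omega)).1 hp).2.2
    · simp only at hsum hs
      have hrh : r < h := by omega
      refine ⟨.inr (.inl r), by simp [firstSteps, hrh, hu], rfl, ?_⟩
      exact ((cons_mem_pathsFrom (by simp only; omega) (by simp only; omega)).1 hp).2.2
    · simp only at hsum hs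
      have hrk : r < k := by omega
      have h3 := (cons_mem_pathsFrom (h' := h) (k' := k - r - 1) (by simp)
        (by simp only; omega)).1 hp
      refine ⟨.inr (.inr r), ?_, rfl, h3.2.2⟩
      have := h3.2.1
      simp only [true_imp_iff] at this
      simp [firstSteps, hrk, hv]
      tauto
  · rintro ⟨i, hi, rfl, hp⟩
    rcases i with r | r | r
    · simp [firstSteps] at hi
      refine (cons_mem_pathsFrom (h' := h + r + 1) (k' := k - r - 1)
        (by simp only [firstStep]; push_cast; ring) (by simp only [firstStep]; omega)).2
        ⟨⟨r, .inl ⟨hi.2, .inl rfl⟩⟩, .inr fun h0 => ?_, hp⟩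
      simp only [firstStep] at h0
      omega
    · simp [firstSteps] at hi
      refine (cons_mem_pathsFrom (h' := h - r - 1) (k' := k)
        (by simp only [firstStep]; omega) (by simp only [firstStep]; omega)).2
        ⟨⟨r, .inl ⟨hi.2, .inr rfl⟩⟩, .inr fun h0 => ?_, hp⟩
      simp only [firstStep] at h0
      omega
    · simp [firstSteps] at hi
      refine (cons_mem_pathsFrom (h' := h) (k' := k - r - 1)
        (by simp [firstStep]) (by simp only [firstStep]; omega)).2
        ⟨⟨r, .inr ⟨hi.2.1, rfl⟩⟩, ?_, hp⟩
      tauto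

theorem finite_and_ncard_biUnion_cons {ι β : Type*} {f : ι → β} (hf : Function.Injective f)
    (I : Finset ι) (W : ι → Set (List β)) (hW : ∀ i ∈ I, (W i).Finite) :
    {l | ∃ i ∈ I, ∃ p ∈ W i, l = f i :: p}.Finite ∧
      {l | ∃ i ∈ I, ∃ p ∈ W i, l = f i :: p}.ncard = ∑ i ∈ I, (W i).ncard := by
  classical
  induction I using Finset.induction_on with
  | empty => simp
  | insert j I hj ih =>
    obtain ⟨h1, h2⟩ := ih fun i hi => hW i (Finset.mem_insert_of_mem hi)
    have hinj : Function.Injective (List.cons (f j)) := fun a c h => (List.cons.inj h).2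
    have hsplit : {l | ∃ i ∈ insert j I, ∃ p ∈ W i, l = f i :: p} =
        (List.cons (f j) '' W j) ∪ {l | ∃ i ∈ I, ∃ p ∈ W i, l = f i :: p} := by
      ext l
      simp [eq_comm]
    have hfin := (hW j (Finset.mem_insert_self j I)).image (List.cons (f j))
    rw [hsplit, Finset.sum_insert hj]
    refine ⟨hfin.union h1, ?_⟩
    rw [Set.ncard_union_eq ?_ hfin h1, h2, Set.ncard_image_of_injective _ hinj]
    rw [Set.disjoint_left]
    rintro _ ⟨p, -, rfl⟩ ⟨i, hi, q, -, h⟩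
    have := hf (List.cons.inj h).1
    exact hj (this ▸ hi)

open Classical in
/-- A family of power series satisfying the first-step recursion counts the paths. -/
theorem ncard_pathsFrom {u v : ℕ → Prop} {b : Prop} {Φ : ℕ → ℝ⟦X⟧}
    (hΦ : ∀ h k, coeff k (Φ h) = (if h = 0 ∧ k = 0 then 1 else 0) +
      (∑ r ∈ (Finset.range k).filter u, coeff (k - r - 1) (Φ (h + r + 1)) +
      (∑ r ∈ (Finset.range h).filter u, coeff k (Φ (h - r - 1)) +
      ∑ r ∈ (Finset.range k).filter fun r => v r ∧ (b ∨ h ≠ 0), coeff (k - r - 1) (Φ h))))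
    (h k : ℕ) : (pathsFrom (stepSet u v) b h k).Finite ∧
      ((pathsFrom (stepSet u v) b h k).ncard : ℝ) = coeff k (Φ h) := by
  -- `2 * k + h` is the horizontal width still to be covered, and every step reduces it. Finiteness
  -- is carried along because `ncard` of an infinite set is zero.
  induction hN : 2 * k + h using Nat.strong_induction_on generalizing h k with
  | _ N ih =>
    have hfin : ∀ i ∈ firstSteps u v b h k, (restPaths (stepSet u v) b h k i).Finite := by
      rintro (r | r | r) hi <;> simp [firstSteps] at hi
      · exact (ih (2 * (k - r - 1) + (h + r + 1)) (by omega) _ _ rfl).1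
      · exact (ih (2 * k + (h - r - 1)) (by omega) _ _ rfl).1
      · exact (ih (2 * (k - r - 1) + h) (by omega) _ _ rfl).1
    obtain ⟨h1, h2⟩ := finite_and_ncard_biUnion_cons firstStep_injective _ _ hfin
    have hsplit : pathsFrom (stepSet u v) b h k = {l | l = [] ∧ h = 0 ∧ k = 0} ∪
        {l | ∃ i ∈ firstSteps u v b h k, ∃ p ∈ restPaths (stepSet u v) b h k i,
          l = firstStep i :: p} := by
      ext l
      cases l with
      | nil => simp [nil_mem_pathsFrom]
      | cons s p =>
        rw [cons_mem_pathsFrom_iff]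
        simp only [Set.mem_union, Set.mem_ofPred_eq, reduceCtorEq, false_and, false_or,
          List.cons.injEq]
        constructor
        · rintro ⟨i, hi, rfl, hp⟩
          exact ⟨i, hi, p, hp, rfl, rfl⟩
        · rintro ⟨i, hi, _, hp, rfl, rfl⟩
          exact ⟨i, hi, rfl, hp⟩
    have h0 : {l : LatticePath | l = [] ∧ h = 0 ∧ k = 0}.Finite :=
      (Set.finite_singleton []).subset fun l hl => hl.1
    have hcard : ({l : LatticePath | l = [] ∧ h = 0 ∧ k = 0}.ncard : ℝ) =
        if h = 0 ∧ k = 0 then 1 else 0 := by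
      split_ifs with hk <;> simp [hk]
    rw [hsplit]
    refine ⟨h0.union h1, ?_⟩
    rw [Set.ncard_union_eq ?_ h0 h1, h2, Nat.cast_add, hcard, hΦ h k, firstSteps,
      Finset.sum_disjSum, Finset.sum_disjSum]
    · push_cast
      congr 1
      refine congrArg₂ _ (Finset.sum_congr rfl fun r hr => ?_)
        (congrArg₂ _ (Finset.sum_congr rfl fun r hr => ?_) (Finset.sum_congr rfl fun r hr => ?_))
      all_goals rw [Finset.mem_filter, Finset.mem_range] at hr
      · exact (ih (2 * (k - r - 1) + (h + r + 1)) (by omega) _ _ rfl).2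
      · exact (ih (2 * k + (h - r - 1)) (by omega) _ _ rfl).2
      · exact (ih (2 * (k - r - 1) + h) (by omega) _ _ rfl).2
    · rw [Set.disjoint_left]
      rintro _ ⟨rfl, -⟩ ⟨i, -, p, -, hp⟩
      exact absurd hp (by simp)

/-! ### The three step sets in the common form -/

theorem S4_eq : S4 = stepSet (fun _ => True) (fun _ => True) := by
  ext s
  simp only [S4, stepSet, Set.mem_ofPred_eq, true_and]
  constructor
  · rintro ⟨r, hr, h⟩
    obtain ⟨n, rfl⟩ : ∃ n : ℕ, r = n + 1 := ⟨(r - 1).toNat, by omega⟩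
    exact ⟨n, by tauto⟩
  · rintro ⟨n, h⟩
    exact ⟨n + 1, by omega, by tauto⟩

theorem S5_eq : S5 = stepSet (fun r => r = 0) (fun _ => True) := by
  ext s
  simp only [S5, stepSet, Set.mem_ofPred_eq, true_and]
  constructor
  · rintro (h | h | ⟨r, hr, h⟩)
    · exact ⟨0, .inl ⟨rfl, .inl (by simpa using h)⟩⟩
    · exact ⟨0, .inl ⟨rfl, .inr (by simpa using h)⟩⟩
    · obtain ⟨n, rfl⟩ : ∃ n : ℕ, r = n + 1 := ⟨(r - 1).toNat, by omega⟩
      exact ⟨n, .inr h⟩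
  · rintro ⟨n, ⟨rfl, h | h⟩ | h⟩
    · exact .inl (by simpa using h)
    · exact .inr (.inl (by simpa using h))
    · exact .inr (.inr ⟨n + 1, by omega, h⟩)

theorem S6_eq : S6 = stepSet (fun _ => True) (fun r => r = 0) := by
  ext s
  simp only [S6, stepSet, Set.mem_ofPred_eq, true_and]
  constructor
  · rintro (⟨r, hr, h⟩ | h)
    · obtain ⟨n, rfl⟩ : ∃ n : ℕ, r = n + 1 := ⟨(r - 1).toNat, by omega⟩
      exact ⟨n, .inl h⟩
    · exact ⟨0, .inr ⟨rfl, by simpa using h⟩⟩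
  · rintro ⟨n, h | ⟨rfl, h⟩⟩
    · exact .inl ⟨n + 1, by omega, h⟩
    · exact .inr (by simpa using h)

/-! ### Solving the recursion by geometric families -/

/-- If `W = X G / (1 - X Y)` then `W = ∑ X ^ (r + 1) Y ^ r G`, coefficientwise. -/
theorem sum_coeff_mul_pow {Y : ℝ⟦X⟧} (k : ℕ) : ∀ {G W : ℝ⟦X⟧}, W = X * G + X * Y * W →
    ∑ r ∈ Finset.range k, coeff (k - r - 1) (G * Y ^ r) = coeff k W := by
  induction k with
  | zero =>
    intro G W hW
    rw [hW]
    simp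
  | succ k ih =>
    intro G W hW
    have hW' : Y * W = X * (G * Y) + X * Y * (Y * W) := by
      linear_combination Y * hW
    have h1 : coeff (k + 1) W = coeff k G + coeff k (Y * W) := by
      conv_lhs => rw [hW, mul_assoc, map_add, coeff_succ_X_mul, coeff_succ_X_mul]
    rw [h1, ← ih hW', Finset.sum_range_succ', add_comm]
    congr 1
    · simp
    · refine Finset.sum_congr rfl fun r _ => ?_
      rw [show k + 1 - (r + 1) - 1 = k - r - 1 by omega, pow_succ']
      ring_nf

open Classical in
/-- `H` is the generating function of the horizontal steps selected by `v`. -/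
def IsHorizSeries (v : ℕ → Prop) (H : ℝ⟦X⟧) : Prop :=
  ∀ (G : ℝ⟦X⟧) (k : ℕ), ∑ r ∈ (Finset.range k).filter v, coeff (k - r - 1) G = coeff k (H * G)

theorem isHorizSeries_all {H : ℝ⟦X⟧} (hH : H * (1 - X) = X) :
    IsHorizSeries (fun _ => True) H := by
  intro G k
  have h := sum_coeff_mul_pow (Y := 1) k (G := G) (W := H * G) (by linear_combination G * hH)
  rw [← h]
  simp

theorem sum_range_filter_eq_zero (f : ℕ → ℝ) (k : ℕ)
    {_ : DecidablePred fun r : ℕ => r = 0} :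
    ∑ r ∈ (Finset.range k).filter (fun r => r = 0), f r = if 0 < k then f 0 else 0 := by
  split_ifs with hk
  · rw [Finset.sum_eq_single_of_mem 0 (by simp [hk])]
    intro r hr h0
    simp at hr
    omega
  · refine Finset.sum_eq_zero fun r hr => ?_
    simp at hr
    omega

theorem isHorizSeries_unit : IsHorizSeries (fun r => r = 0) X := by
  intro G k
  rw [sum_range_filter_eq_zero]
  cases k with
  | zero => simp
  | succ k => simp [coeff_succ_X_mul]

open Classical in
theorem IsHorizSeries.sum_and {v : ℕ → Prop} {H : ℝ⟦X⟧} (hH : IsHorizSeries v H) (q : Prop)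
    {_ : DecidablePred fun r => v r ∧ q} (G : ℝ⟦X⟧) (k : ℕ) :
    ∑ r ∈ (Finset.range k).filter (fun r => v r ∧ q), coeff (k - r - 1) G =
      if q then coeff k (H * G) else 0 := by
  split_ifs with hq
  · rw [← hH G k]
    simp [hq]
  · simp [hq]

/-- The generating functions, by initial height, for paths with diagonal steps of all lengths. -/
noncomputable def steepFamily (E Y : ℝ⟦X⟧) : ℕ → ℝ⟦X⟧
  | 0 => E
  | h + 1 => E * (Y - 1) * Y ^ h

theorem sum_steepFamily (E Y : ℝ⟦X⟧) (h : ℕ) :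
    ∑ j ∈ Finset.range (h + 1), steepFamily E Y j = E * Y ^ h := by
  induction h with
  | zero => simp [steepFamily]
  | succ h ih =>
    rw [Finset.sum_range_succ, ih, steepFamily]
    ring

open Classical in
-- Kernel method. The partial sums of `steepFamily` telescope to `E * Y ^ h`, which handles all down
-- steps at once; the up steps form a geometric series with sum `E * Y ^ h * P`. The recursion at
-- positive heights then reduces to `hY`, independent of the height, and at height zero to `hE`.
theorem ncard_steep {v : ℕ → Prop} {b : Prop} {H P Y E : ℝ⟦X⟧} (hH : IsHorizSeries v H)
    (hP : P * (1 - X * Y) = X * (Y - 1)) (hY : (Y - 1) * (1 - H) = Y * P + 1)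
    (hE : E = 1 + E * P + if b then H * E else 0) (n : ℕ) :
    ((pathsFrom (stepSet (fun _ => True) v) b 0 n).ncard : ℝ) = coeff n E := by
  refine (ncard_pathsFrom (Φ := steepFamily E Y) ?_ 0 n).2
  intro h k
  have hup : ∑ r ∈ Finset.range k,
      coeff (k - r - 1) (steepFamily E Y (h + r + 1)) = coeff k (E * Y ^ h * P) := by
    have h1 := sum_coeff_mul_pow (Y := Y) k (G := E * (Y - 1) * Y ^ h) (W := E * Y ^ h * P)
      (by linear_combination E * Y ^ h * hP)
    rw [← h1]
    refine Finset.sum_congr rfl fun r _ => ?_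
    rw [steepFamily, pow_add, mul_assoc _ (Y ^ h)]
  have hdown : ∑ r ∈ Finset.range h,
      coeff k (steepFamily E Y (h - r - 1)) =
      coeff k (∑ j ∈ Finset.range h, steepFamily E Y j) := by
    rw [map_sum, ← Finset.sum_range_reflect (fun j => coeff k (steepFamily E Y j))]
    refine Finset.sum_congr rfl fun r hr => ?_
    rw [Finset.mem_range] at hr
    rw [show h - 1 - r = h - r - 1 by omega]
  simp only [Finset.filter_true]
  rw [hup, hdown, hH.sum_and]
  cases h with
  | zero =>
    have h2 := congrArg (coeff k) hE
    simp only [map_add, coeff_one] at h2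
    simp only [steepFamily, true_and, ne_eq, not_true_eq_false, or_false, pow_zero, mul_one,
      Finset.range_zero, Finset.sum_empty, map_zero, zero_add]
    rw [h2]
    split_ifs <;> simp [add_assoc]
  | succ h =>
    rw [sum_steepFamily, if_neg (by simp), if_pos (by simp), zero_add, ← map_add, ← map_add]
    congr 1
    rw [steepFamily]
    linear_combination E * Y ^ h * hY

open Classical in
-- The descent from height `h` factors into `h` first passages one level down, whence the ansatz `E
-- * M ^ h`. Only `E`, the series at height zero, depends on whether axis steps are allowed.
theorem ncard_flat {v : ℕ → Prop} {b : Prop} {H M E : ℝ⟦X⟧} (hH : IsHorizSeries v H)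
    (hM : M = 1 + X * M ^ 2 + H * M)
    (hE : E = 1 + X * E * M + if b then H * E else 0) (n : ℕ) :
    ((pathsFrom (stepSet (fun r => r = 0) v) b 0 n).ncard : ℝ) = coeff n E := by
  have hmain := (ncard_pathsFrom (u := fun r => r = 0) (v := v) (b := b)
    (Φ := fun h => E * M ^ h) ?_ 0 n).2
  · simpa using hmain
  intro h k
  rw [hH.sum_and, sum_range_filter_eq_zero, sum_range_filter_eq_zero]
  have hup : (if 0 < k then coeff (k - 0 - 1) (E * M ^ (h + 0 + 1)) else 0) =
      coeff k (X * (E * M ^ (h + 1))) := by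
    cases k with
    | zero => simp
    | succ k => simp [coeff_succ_X_mul]
  rw [hup]
  cases h with
  | zero =>
    have h2 := congrArg (coeff k) hE
    simp only [map_add, coeff_one] at h2
    simp only [true_and, ne_eq, not_true_eq_false, or_false, pow_zero, mul_one, lt_self_iff_false,
      if_false, zero_add, pow_one, ← mul_assoc]
    rw [h2]
    split_ifs <;> simp [add_assoc]
  | succ h =>
    rw [if_neg (by simp), if_pos (by simp), if_pos (by simp), zero_add, ← map_add, ← map_add]
    congr 1
    simp only [Nat.sub_zero, Nat.add_sub_cancel]
    linear_combination E * M ^ h * hM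

/-- The counting series for diagonal steps of all lengths, in terms of the arch series `P`. -/
theorem ncard_steep_of_quadratic {v : ℕ → Prop} {H P A' L' : ℝ⟦X⟧} (hH : IsHorizSeries v H)
    (hP0 : constantCoeff P = 0) (hP : P ^ 2 + P * (H - 1 + 3 * X - X * H) + X = 0)
    (hA : (1 - P) * A' = 1) (hL : (1 - P - H) * L' = 1) (n : ℕ) :
    ((L (stepSet (fun _ => True) v) n).ncard : ℝ) = coeff n L' ∧
      ((A (stepSet (fun _ => True) v) n).ncard : ℝ) = coeff n A' := by
  -- With `P = X * Q`, the relation between `P` and `Y` becomes linear in `Y`, with solution `Y = (Q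
  -- + 1) / (1 + X * Q)`. Substituting this in the kernel equation gives back the quadratic.
  obtain ⟨Q, rfl⟩ := X_dvd_iff.2 hP0
  have h1 : (1 + X * Q) * (1 + X * Q)⁻¹ = 1 := PowerSeries.mul_inv_cancel _ (by simp)
  have hY1 : X * Q * (1 - X * ((Q + 1) * (1 + X * Q)⁻¹)) = X * ((Q + 1) * (1 + X * Q)⁻¹ - 1) := by
    linear_combination -X * (Q + 1) * h1
  have hQ : X * Q ^ 2 + Q * (H - 1 + 3 * X - X * H) + 1 = 0 := by
    refine mul_left_cancel₀ (X_ne_zero : (X : ℝ⟦X⟧) ≠ 0) ?_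
    linear_combination hP
  have hY2 : ((Q + 1) * (1 + X * Q)⁻¹ - 1) * (1 - H) = (Q + 1) * (1 + X * Q)⁻¹ * (X * Q) + 1 := by
    linear_combination (2 - H) * h1 - hQ * (1 + X * Q)⁻¹
  rw [L_eq_pathsFrom, A_eq_pathsFrom]
  refine ⟨ncard_steep hH hY1 hY2 ?_ n, ncard_steep hH hY1 hY2 ?_ n⟩
  · rw [if_pos trivial]
    linear_combination hL
  · rw [if_neg not_false]
    linear_combination hA

/-- The counting series for unit diagonal steps, in terms of the arch series `X M`. -/
theorem ncard_flat_of_quadratic {v : ℕ → Prop} {H M A' : ℝ⟦X⟧} (hH : IsHorizSeries v H)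
    (hM : M = 1 + X * M ^ 2 + H * M) (hA : (1 - X * M) * A' = 1) (n : ℕ) :
    ((L (stepSet (fun r => r = 0) v) n).ncard : ℝ) = coeff n M ∧
      ((A (stepSet (fun r => r = 0) v) n).ncard : ℝ) = coeff n A' := by
  rw [L_eq_pathsFrom, A_eq_pathsFrom]
  -- With axis steps allowed, the axis is no different from any other level, so `E = M` solves the
  -- equation at height zero.
  refine ⟨ncard_flat hH hM ?_ n, ncard_flat hH hM ?_ n⟩
  · rw [if_pos trivial]
    linear_combination hM
  · rw [if_neg not_false]
    linear_combination hA

/-! ### From square roots of discriminants to the limits -/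

theorem CoeffAsymp.polynomial_mul {c : ℕ → ℝ} {α : ℝ} {F : ℝ⟦X⟧} {m : ℝ} (hc : RatioSeq c α)
    (p : Polynomial ℝ) (hF : CoeffAsymp c F m) : CoeffAsymp c ((p : ℝ⟦X⟧) * F) (p.eval α * m) := by
  have hz : ∀ k ∉ Finset.range (p.natDegree + 1), coeff k (p : ℝ⟦X⟧) = 0 := fun k hk => by
    rw [Polynomial.coeff_coe]
    exact Polynomial.coeff_eq_zero_of_natDegree_lt (by simpa using hk)
  have := hF.mul_left hc (G := p) (lt_add_one α)
    (summable_of_ne_finset_zero (s := Finset.range (p.natDegree + 1))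
      fun k hk => by rw [hz k hk]; simp)
  rwa [tsum_eq_sum (s := Finset.range (p.natDegree + 1)) fun k hk => by rw [hz k hk, zero_mul],
    show ∑ k ∈ Finset.range (p.natDegree + 1), coeff k (p : ℝ⟦X⟧) * α ^ k = p.eval α by
      rw [Polynomial.eval_eq_sum_range]
      simp] at this

/-- Adding a polynomial does not change the asymptotics of a polynomial multiple. -/
theorem CoeffAsymp.polynomial_add_mul {c : ℕ → ℝ} {α : ℝ} {F : ℝ⟦X⟧} {m : ℝ}
    (hc : RatioSeq c α) (p q : Polynomial ℝ) (hF : CoeffAsymp c F m) :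
    CoeffAsymp c ((p : ℝ⟦X⟧) + (q : ℝ⟦X⟧) * F) (q.eval α * m) := by
  have := ((coeffAsymp_one c).polynomial_mul hc p).add (hF.polynomial_mul hc q)
  simpa using this

theorem coeffAsymp_self {γ : ℝ} (hγ : 0 < γ) :
    CoeffAsymp (fun n => coeff n (sqrtSeries γ)) (sqrtSeries γ) 1 :=
  tendsto_const_nhds.congr fun n => (div_self ((ratioSeq_sqrtSeries hγ).ne_zero n)).symm

theorem coe_two_polynomial : (((2 : Polynomial ℝ)) : ℝ⟦X⟧) = 2 :=
  map_ofNat Polynomial.coeToPowerSeries.ringHom 2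

theorem coe_three_polynomial : (((3 : Polynomial ℝ)) : ℝ⟦X⟧) = 3 :=
  map_ofNat Polynomial.coeToPowerSeries.ringHom 3

theorem coe_four_polynomial : (((4 : Polynomial ℝ)) : ℝ⟦X⟧) = 4 :=
  map_ofNat Polynomial.coeToPowerSeries.ringHom 4

theorem CoeffAsymp.of_ofNat_mul {c : ℕ → ℝ} {F : ℝ⟦X⟧} {m : ℝ} (k : ℕ) [k.AtLeastTwo]
    (hF : CoeffAsymp c (OfNat.ofNat k * F) m) : CoeffAsymp c F (m / OfNat.ofNat k) := by
  have h := hF.C_mul (OfNat.ofNat k : ℝ)⁻¹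
  rw [← map_ofNat C k, ← mul_assoc, ← map_mul,
    inv_mul_cancel₀ (NeZero.ne (OfNat.ofNat k : ℝ)), map_one, one_mul] at h
  rwa [div_eq_inv_mul]

/-- Division by `a - b X` with `a / b` outside the closed disc of radius `α`. -/
theorem CoeffAsymp.of_affine_mul {c : ℕ → ℝ} {α : ℝ} {F : ℝ⟦X⟧} {m : ℝ} (hc : RatioSeq c α)
    {a b : ℝ} (ha : 0 < a) (h : |b| * α < a) (hF : CoeffAsymp c ((C a - C b * X) * F) m) :
    CoeffAsymp c F (m / (a - b * α)) := by
  have h1 := hF.C_mul a⁻¹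
  have h2 : (C a⁻¹ : ℝ⟦X⟧) * C a = 1 := by rw [← map_mul, inv_mul_cancel₀ ha.ne', map_one]
  have h3 : (C (b / a) : ℝ⟦X⟧) = C a⁻¹ * C b := by rw [← map_mul, div_eq_inv_mul]
  have h4 : C a⁻¹ * ((C a - C b * X) * F) = (1 - C (b / a) * X) * F := by
    rw [h3]
    linear_combination F * h2
  rw [h4] at h1
  have h5 : |b / a| * α < 1 := by
    rw [abs_div, abs_of_pos ha, div_mul_eq_mul_div, div_lt_one ha]
    exact h
  have h6 := CoeffAsymp.of_linear_mul hc h5 h1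
  have h7 : a - b * α ≠ 0 := by
    have := le_abs_self b
    have := hc.pos
    nlinarith
  convert h6 using 1
  field_simp

/-- Given a square root `T` of the discriminant, the arch series `P` for steep steps exists and
inherits the asymptotics of `T`. -/
theorem exists_steep_series {c : ℕ → ℝ} {α m : ℝ} (hc : RatioSeq c α) {v : ℕ → Prop}
    {H T : ℝ⟦X⟧} {B : Polynomial ℝ} (hH : IsHorizSeries v H) (hH0 : constantCoeff H = 0)
    (hB : (B : ℝ⟦X⟧) = 1 - 3 * X - H + X * H) (hT2 : T ^ 2 = (B : ℝ⟦X⟧) ^ 2 - 4 * X)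
    (hT0 : constantCoeff T = 1) (hT : CoeffAsymp c T m) (hm : m ≠ 0) :
    ∃ P A' L' : ℝ⟦X⟧, ∃ μ ≠ 0, CoeffAsymp c P μ ∧ P ^ 2 - P * (B : ℝ⟦X⟧) + X = 0 ∧ (1 - P) * A' = 1 ∧
      (1 - P - H) * L' = 1 ∧ ∀ n,
      ((L (stepSet (fun _ => True) v) n).ncard : ℝ) = coeff n L' ∧
      ((A (stepSet (fun _ => True) v) n).ncard : ℝ) = coeff n A' := by
  have hC : (C (1 / 2) : ℝ⟦X⟧) * 2 = 1 := by rw [← map_ofNat C 2, ← map_mul]; norm_num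
  have hB0 : constantCoeff (B : ℝ⟦X⟧) = 1 := by simp [hB, hH0]
  -- The minus sign selects the root of the quadratic with zero constant term, as `B` and `T` both
  -- have constant term 1.
  obtain ⟨P, hPdef⟩ : ∃ P : ℝ⟦X⟧, P = C (1 / 2) * ((B : ℝ⟦X⟧) - T) := ⟨_, rfl⟩
  have hP0 : constantCoeff P = 0 := by rw [hPdef, map_mul, map_sub, hT0, hB0, sub_self, mul_zero]
  have hPT : 2 * P = (B : ℝ⟦X⟧) - T := by rw [hPdef]; linear_combination ((B : ℝ⟦X⟧) - T) * hC
  have hP : P ^ 2 - P * (B : ℝ⟦X⟧) + X = 0 := by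
    have h4 : (4 : ℝ⟦X⟧) ≠ 0 := by
      rw [← map_ofNat C 4]
      exact (map_ne_zero_iff C C_injective).2 four_ne_zero
    refine mul_left_cancel₀ h4 ?_
    linear_combination (2 * P - B - T) * hPT + hT2
  have hPas := CoeffAsymp.of_ofNat_mul (c := c) (F := P) 2
    (m := ((-1 : Polynomial ℝ)).eval α * m) (by
      convert hT.polynomial_add_mul hc B (-1) using 1
      rw [show ((OfNat.ofNat 2 : ℝ⟦X⟧)) = 2 from rfl, hPT, Polynomial.coe_neg, Polynomial.coe_one]
      ring)
  have hA : (1 - P) * (1 - P)⁻¹ = 1 := PowerSeries.mul_inv_cancel _ (by simp [hP0])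
  have hL : (1 - P - H) * (1 - P - H)⁻¹ = 1 := PowerSeries.mul_inv_cancel _ (by simp [hP0, hH0])
  refine ⟨P, _, _, _, ?_, hPas, hP, hA, hL, ncard_steep_of_quadratic hH hP0 ?_ hA hL⟩
  · simpa using hm
  · linear_combination hP + P * hB

theorem tendsto_S4 {α γ : ℝ} (hα : 0 < α) (hα' : α < 1 / 2)
    (hsum : α⁻¹ + γ = 12) (hprod : α⁻¹ * γ = 16) (hγ : |γ| * α < 1) :
    Tendsto (fun n : ℕ => ((L S4 n).ncard : ℝ) / ((A S4 n).ncard : ℝ)) atTop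
      (𝓝 (5 * (1 - α) ^ 2 / (2 - 3 * α) ^ 2)) := by
  have hc := ratioSeq_sqrtSeries (inv_pos.2 hα)
  rw [inv_inv] at hc
  obtain ⟨m, hm, hT⟩ := (coeffAsymp_self (inv_pos.2 hα)).sqrtSeries_mul hc hγ one_ne_zero
  obtain ⟨T, hTdef⟩ : ∃ T, T = sqrtSeries γ * sqrtSeries α⁻¹ := ⟨_, rfl⟩
  rw [← hTdef] at hT
  have hT2 : T ^ 2 = 1 - 12 * X + 16 * X ^ 2 := by
    have h1 : (C α⁻¹ : ℝ⟦X⟧) + C γ = 12 := by rw [← map_add, hsum, map_ofNat]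
    have h2 : (C α⁻¹ : ℝ⟦X⟧) * C γ = 16 := by rw [← map_mul, hprod, map_ofNat]
    rw [hTdef, mul_pow, sq, sq, sqrtSeries_mul_self, sqrtSeries_mul_self]
    linear_combination -X * h1 + X ^ 2 * h2
  have hT0 : constantCoeff T = 1 := by
    rw [hTdef, map_mul, constantCoeff_sqrtSeries, constantCoeff_sqrtSeries, one_mul]
  obtain ⟨H, hHdef⟩ : ∃ H : ℝ⟦X⟧, H = X * (1 - X)⁻¹ := ⟨_, rfl⟩
  have hH : H * (1 - X) = X := by
    rw [hHdef, mul_assoc, PowerSeries.inv_mul_cancel _ (by simp), mul_one]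
  have hB : ((1 - 4 * Polynomial.X : Polynomial ℝ) : ℝ⟦X⟧) = 1 - 4 * X := by
    simp only [Polynomial.coe_sub, Polynomial.coe_mul, Polynomial.coe_one, Polynomial.coe_X,
      coe_four_polynomial]
  obtain ⟨P, A', L', μ, hμ, hP_as, hP, hA, hL, hcount⟩ :=
    exists_steep_series hc (B := 1 - 4 * Polynomial.X) (isHorizSeries_all hH) (by simp [hHdef])
      (by rw [hB]; linear_combination hH) (by rw [hB, hT2]; ring) hT0 hT hm
  rw [hB] at hP
  -- Multiplication by the conjugate: the roots `P`, `P'` of the quadratic have sum `1 - 4X` and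
  -- product `X`, so `(1 - P)(1 - P') = 5X` and `1 - P' = 4X + P`.
  have hA' : X * (5 * A') =
      ((4 * Polynomial.X : Polynomial ℝ) : ℝ⟦X⟧) + ((1 : Polynomial ℝ) : ℝ⟦X⟧) * P := by
    simp only [Polynomial.coe_mul, Polynomial.coe_X, Polynomial.coe_one, coe_four_polynomial]
    linear_combination (4 * X + P) * hA + A' * hP
  -- After clearing the denominator `1 - X` of `H`, the product of `(1 - 2X) - P(1 - X)` with its
  -- conjugate is `X(2 - 3X)²`. This is the origin of the squared factor in the limit.
  have hL' : X * ((C 2 - C 3 * X) * ((C 2 - C 3 * X) * L')) =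
      (((1 - Polynomial.X) * (1 - 2 * Polynomial.X) -
        (1 - Polynomial.X) ^ 2 * (1 - 4 * Polynomial.X) : Polynomial ℝ) : ℝ⟦X⟧) +
      (((1 - Polynomial.X) ^ 2 : Polynomial ℝ) : ℝ⟦X⟧) * P := by
    have hL2 : ((1 - 2 * X) - P * (1 - X)) * L' = 1 - X := by
      linear_combination (1 - X) * hL + L' * hH
    simp only [Polynomial.coe_mul, Polynomial.coe_X, Polynomial.coe_sub, Polynomial.coe_one,
      Polynomial.coe_pow, coe_two_polynomial,
      coe_four_polynomial, map_ofNat]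
    linear_combination (-(1 - X) * (1 - 4 * X - P) + (1 - 2 * X)) * hL2 + (1 - X) ^ 2 * L' * hP
  have hA_as := CoeffAsymp.of_ofNat_mul 5
    (CoeffAsymp.of_X_mul hc (hA' ▸ hP_as.polynomial_add_mul hc _ _))
  have hr : |(3 : ℝ)| * α < 2 := by rw [abs_of_pos (by norm_num)]; linarith
  have hL_as := CoeffAsymp.of_affine_mul hc two_pos hr (CoeffAsymp.of_affine_mul hc two_pos hr
    (CoeffAsymp.of_X_mul hc (hL' ▸ hP_as.polynomial_add_mul hc _ _)))
  rw [S4_eq]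
  simp only [hcount]
  simp only [Polynomial.eval_pow, Polynomial.eval_sub, Polynomial.eval_one,
    Polynomial.eval_X] at hA_as hL_as
  convert CoeffAsymp.tendsto_ratio hc hL_as hA_as ?_ using 2
  · have h1 : (2 - 3 * α) ≠ 0 := by linarith
    have := hα.ne'
    field_simp
  · have := hα.ne'
    positivity

theorem tendsto_S6 {α γ δ : ℝ} (hα : 0 < α) (hα' : α < 1)
    (h1 : α⁻¹ + γ + δ = 11) (h2 : α⁻¹ * γ + α⁻¹ * δ + γ * δ = 7) (h3 : α⁻¹ * γ * δ = 1)
    (hγ : |γ| * α < 1) (hδ : |δ| * α < 1) :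
    Tendsto (fun n : ℕ => ((L S6 n).ncard : ℝ) / ((A S6 n).ncard : ℝ)) atTop
      (𝓝 ((5 - α) / (2 - α) ^ 2)) := by
  have hc := ratioSeq_sqrtSeries (inv_pos.2 hα)
  rw [inv_inv] at hc
  obtain ⟨m₁, hm₁, hT₁⟩ := (coeffAsymp_self (inv_pos.2 hα)).sqrtSeries_mul hc hγ one_ne_zero
  obtain ⟨m₂, hm₂, hT₂⟩ := hT₁.sqrtSeries_mul hc hδ hm₁
  obtain ⟨m, hm, hT⟩ := hT₂.sqrtSeries_mul hc (γ := 1) (by simpa using hα') hm₂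
  obtain ⟨T, hTdef⟩ : ∃ T, T = sqrtSeries 1 * (sqrtSeries δ * (sqrtSeries γ * sqrtSeries α⁻¹)) :=
    ⟨_, rfl⟩
  rw [← hTdef] at hT
  have hT2 : T ^ 2 = (1 - X) * (1 - 11 * X + 7 * X ^ 2 - X ^ 3) := by
    have e1 : (C α⁻¹ : ℝ⟦X⟧) + C γ + C δ = 11 := by rw [← map_add, ← map_add, h1, map_ofNat]
    have e2 : (C α⁻¹ : ℝ⟦X⟧) * C γ + C α⁻¹ * C δ + C γ * C δ = 7 := by
      simp only [← map_mul, ← map_add, h2, map_ofNat]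
    have e3 : (C α⁻¹ : ℝ⟦X⟧) * C γ * C δ = 1 := by simp only [← map_mul, h3, map_one]
    rw [hTdef]
    simp only [mul_pow, sq (sqrtSeries _), sqrtSeries_mul_self, map_one]
    linear_combination (1 - X) * (-X * e1 + X ^ 2 * e2 - X ^ 3 * e3)
  have hT0 : constantCoeff T = 1 := by
    simp only [hTdef, map_mul, constantCoeff_sqrtSeries, one_mul]
  have hB : ((1 - 4 * Polynomial.X + Polynomial.X ^ 2 : Polynomial ℝ) : ℝ⟦X⟧) =
      1 - 4 * X + X ^ 2 := by
    simp only [Polynomial.coe_add, Polynomial.coe_sub, Polynomial.coe_mul, Polynomial.coe_one,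
      Polynomial.coe_X, Polynomial.coe_pow, coe_four_polynomial]
  obtain ⟨P, A', L', μ, hμ, hP_as, hP, hA, hL, hcount⟩ :=
    exists_steep_series hc (B := 1 - 4 * Polynomial.X + Polynomial.X ^ 2) isHorizSeries_unit
      constantCoeff_X (by rw [hB]; ring) (by rw [hB, hT2]; ring) hT0 hT hm
  rw [hB] at hP
  -- The roots now have sum `1 - 4X + X²` and product `X`. The norms of `1 - P` and `1 - X - P` are
  -- `X(5 - X)` and `X(2 - X)²`.
  have hA' : X * ((C 5 - C 1 * X) * A') =
      ((4 * Polynomial.X - Polynomial.X ^ 2 : Polynomial ℝ) : ℝ⟦X⟧) +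
        ((1 : Polynomial ℝ) : ℝ⟦X⟧) * P := by
    simp only [Polynomial.coe_sub, Polynomial.coe_mul, Polynomial.coe_X, Polynomial.coe_one,
      Polynomial.coe_pow, coe_four_polynomial, map_ofNat, map_one]
    linear_combination (4 * X - X ^ 2 + P) * hA + A' * hP
  have hL' : X * ((C 2 - C 1 * X) * ((C 2 - C 1 * X) * L')) =
      ((3 * Polynomial.X - Polynomial.X ^ 2 : Polynomial ℝ) : ℝ⟦X⟧) +
      ((1 : Polynomial ℝ) : ℝ⟦X⟧) * P := by
    simp only [Polynomial.coe_mul, Polynomial.coe_X, Polynomial.coe_sub, Polynomial.coe_one,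
      Polynomial.coe_pow, coe_three_polynomial, map_ofNat, map_one]
    linear_combination (3 * X - X ^ 2 + P) * hL + L' * hP
  have hA_as := CoeffAsymp.of_affine_mul hc (by norm_num) (by rw [abs_one]; linarith)
    (CoeffAsymp.of_X_mul hc (hA' ▸ hP_as.polynomial_add_mul hc _ _))
  have hr : |(1 : ℝ)| * α < 2 := by rw [abs_one]; linarith
  have hL_as := CoeffAsymp.of_affine_mul hc two_pos hr (CoeffAsymp.of_affine_mul hc two_pos hr
    (CoeffAsymp.of_X_mul hc (hL' ▸ hP_as.polynomial_add_mul hc _ _)))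
  rw [S6_eq]
  simp only [hcount]
  simp only [Polynomial.eval_one] at hA_as hL_as
  have h5 : (5 - 1 * α) ≠ 0 := by linarith
  have h6 : (5 - α) ≠ 0 := by linarith
  have h7 : (2 - α) ≠ 0 := by linarith
  have h8 := hα.ne'
  convert CoeffAsymp.tendsto_ratio hc hL_as hA_as ?_ using 2
  · rw [one_mul]
    field_simp
  · exact div_ne_zero (div_ne_zero (by simpa using hμ) h8) h5

theorem tendsto_S5 {α γ δ : ℝ} (hα : 0 < α) (hα' : α < 1)
    (h1 : α⁻¹ + γ + δ = 8) (h2 : α⁻¹ * γ + α⁻¹ * δ + γ * δ = 12) (h3 : α⁻¹ * γ * δ = 4)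
    (hγ : |γ| * α < 1) (hδ : |δ| * α < 1) :
    Tendsto (fun n : ℕ => ((L S5 n).ncard : ℝ) / ((A S5 n).ncard : ℝ)) atTop
      (𝓝 ((2 - α) / (1 - α))) := by
  have hc := ratioSeq_sqrtSeries (inv_pos.2 hα)
  rw [inv_inv] at hc
  obtain ⟨m₁, hm₁, hT₁⟩ := (coeffAsymp_self (inv_pos.2 hα)).sqrtSeries_mul hc hγ one_ne_zero
  obtain ⟨m, hm, hT⟩ := hT₁.sqrtSeries_mul hc hδ hm₁
  obtain ⟨T, hTdef⟩ : ∃ T, T = sqrtSeries δ * (sqrtSeries γ * sqrtSeries α⁻¹) := ⟨_, rfl⟩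
  rw [← hTdef] at hT
  have hT2 : T ^ 2 = 1 - 8 * X + 12 * X ^ 2 - 4 * X ^ 3 := by
    have e1 : (C α⁻¹ : ℝ⟦X⟧) + C γ + C δ = 8 := by rw [← map_add, ← map_add, h1, map_ofNat]
    have e2 : (C α⁻¹ : ℝ⟦X⟧) * C γ + C α⁻¹ * C δ + C γ * C δ = 12 := by
      simp only [← map_mul, ← map_add, h2, map_ofNat]
    have e3 : (C α⁻¹ : ℝ⟦X⟧) * C γ * C δ = 4 := by simp only [← map_mul, h3, map_ofNat]
    rw [hTdef]
    simp only [mul_pow, sq (sqrtSeries _), sqrtSeries_mul_self]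
    linear_combination -X * e1 + X ^ 2 * e2 - X ^ 3 * e3
  have hT0 : constantCoeff T = 1 := by
    simp only [hTdef, map_mul, constantCoeff_sqrtSeries, one_mul]
  have hinv : (1 - X : ℝ⟦X⟧) * (1 - X)⁻¹ = 1 := PowerSeries.mul_inv_cancel _ (by simp)
  obtain ⟨H, hHdef⟩ : ∃ H : ℝ⟦X⟧, H = X * (1 - X)⁻¹ := ⟨_, rfl⟩
  have hH : H * (1 - X) = X := by rw [hHdef]; linear_combination X * hinv
  have hC : (C (1 / 2) : ℝ⟦X⟧) * 2 = 1 := by rw [← map_ofNat C 2, ← map_mul]; norm_num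
  -- `M = (1 - 2X - T) / (2X(1 - X))`, with the sign that makes the numerator divisible by `X`.
  obtain ⟨M, hMdef⟩ : X ∣ C (1 / 2) * (1 - X)⁻¹ * (1 - 2 * X - T) := by
    rw [X_dvd_iff]
    simp [hT0]
  have hMT : 2 * (X * ((1 - X) * M)) = 1 - 2 * X - T := by
    linear_combination -2 * (1 - X) * hMdef + (1 - 2 * X - T) * hC +
      2 * C (1 / 2) * (1 - 2 * X - T) * hinv
  have hM : M = 1 + X * M ^ 2 + H * M := by
    have h4 : (4 * X * (1 - X) ^ 2 : ℝ⟦X⟧) ≠ 0 := by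
      refine mul_ne_zero (mul_ne_zero ?_ X_ne_zero) (pow_ne_zero _ (left_ne_zero_of_mul_eq_one hinv))
      rw [← map_ofNat C 4]
      exact (map_ne_zero_iff C C_injective).2 four_ne_zero
    refine mul_left_cancel₀ h4 ?_
    linear_combination (-(2 * (X * ((1 - X) * M)) - (1 - 2 * X) - T)) * hMT - hT2 -
      4 * X * (1 - X) * M * hH
  have hA : (1 - X * M) * (1 - X * M)⁻¹ = 1 := PowerSeries.mul_inv_cancel _ (by simp)
  generalize (1 - X * M)⁻¹ = A' at hA
  have hcount := ncard_flat_of_quadratic (isHorizSeries_all hH) hM hA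
  have hL' : 2 * (X * ((C 1 - C 1 * X) * M)) =
      ((1 - 2 * Polynomial.X : Polynomial ℝ) : ℝ⟦X⟧) + ((-1 : Polynomial ℝ) : ℝ⟦X⟧) * T := by
    simp only [Polynomial.coe_sub, Polynomial.coe_mul, Polynomial.coe_X, Polynomial.coe_one,
      Polynomial.coe_neg, coe_two_polynomial, map_one]
    linear_combination hMT
  -- The norm of `1 - X * M` is `X(2 - X)/(1 - X)`; its denominator cancels against that of the
  -- conjugate.
  have hA' : 2 * (X * ((C 2 - C 1 * X) * A')) =
      ((1 : Polynomial ℝ) : ℝ⟦X⟧) + ((-1 : Polynomial ℝ) : ℝ⟦X⟧) * T := by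
    have hM' : (1 - X) * M = (1 - X) + X * (1 - X) * M ^ 2 + X * M := by
      linear_combination (1 - X) * hM + M * hH
    simp only [Polynomial.coe_one, Polynomial.coe_neg, map_one, map_ofNat]
    linear_combination hMT + 2 * (X + (1 - X) * (X * M)) * hA - 2 * X * A' * hM'
  have hr : |(1 : ℝ)| * α < 1 := by rwa [abs_one, one_mul]
  have hL_as := CoeffAsymp.of_affine_mul hc one_pos hr (CoeffAsymp.of_X_mul hc
    (CoeffAsymp.of_ofNat_mul 2 (hL' ▸ hT.polynomial_add_mul hc _ _)))
  have hA_as := CoeffAsymp.of_affine_mul hc two_pos (hr.trans one_lt_two) (CoeffAsymp.of_X_mul hc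
    (CoeffAsymp.of_ofNat_mul 2 (hA' ▸ hT.polynomial_add_mul hc _ _)))
  rw [S5_eq]
  simp only [hcount]
  simp only [Polynomial.eval_neg, Polynomial.eval_one, one_mul] at hA_as hL_as
  have h6 : (1 - α) ≠ 0 := by linarith
  have h7 : (2 - α) ≠ 0 := by linarith
  have h8 := hα.ne'
  convert CoeffAsymp.tendsto_ratio hc hL_as hA_as ?_ using 2
  · field_simp
  · exact div_ne_zero (div_ne_zero (div_ne_zero (by simpa using hm) two_ne_zero) h8) h7

/-! ### Roots of the three polynomials -/

/-- Vieta's formulas for a monic cubic with three distinct roots. -/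
theorem vieta_cubic {a b c x y z : ℝ} (hx : x ^ 3 - a * x ^ 2 + b * x - c = 0)
    (hy : y ^ 3 - a * y ^ 2 + b * y - c = 0) (hz : z ^ 3 - a * z ^ 2 + b * z - c = 0)
    (hxy : x < y) (hyz : y < z) :
    x + y + z = a ∧ x * y + x * z + y * z = b ∧ x * y * z = c := by
  have h1 : x ^ 2 + x * y + y ^ 2 - a * (x + y) + b = 0 :=
    mul_left_cancel₀ (sub_ne_zero.2 hxy.ne) (by linear_combination hx - hy)
  have h2 : y ^ 2 + y * z + z ^ 2 - a * (y + z) + b = 0 :=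
    mul_left_cancel₀ (sub_ne_zero.2 hyz.ne) (by linear_combination hy - hz)
  have ha : x + y + z = a := by
    have h3 : x + y + z - a = 0 :=
      mul_left_cancel₀ (sub_ne_zero.2 (hxy.trans hyz).ne) (by linear_combination h1 - h2)
    linarith
  have hb : x * y + x * z + y * z = b := by
    subst ha
    linear_combination -h1
  refine ⟨ha, hb, ?_⟩
  subst ha hb
  linear_combination hx

theorem exists_root_of_neg_of_pos {f : ℝ → ℝ} (hf : Continuous f) {a b : ℝ} (hab : a ≤ b)
    (ha : f a < 0) (hb : 0 < f b) : ∃ x, a < x ∧ x < b ∧ f x = 0 := by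
  obtain ⟨x, ⟨h1, h2⟩, h3⟩ := intermediate_value_Ioo hab hf.continuousOn ⟨ha, hb⟩
  exact ⟨x, h1, h2, h3⟩

theorem exists_root_of_pos_of_neg {f : ℝ → ℝ} (hf : Continuous f) {a b : ℝ} (hab : a ≤ b)
    (ha : 0 < f a) (hb : f b < 0) : ∃ x, a < x ∧ x < b ∧ f x = 0 := by
  obtain ⟨x, ⟨h1, h2⟩, h3⟩ := intermediate_value_Ioo' hab hf.continuousOn ⟨hb, ha⟩
  exact ⟨x, h1, h2, h3⟩

/-- The reciprocals of the roots of a cubic have the elementary symmetric functions of the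
reversed cubic. -/
theorem inv_symmetric {a b c x y z : ℝ} (hx : x ≠ 0) (hy : y ≠ 0) (hz : z ≠ 0)
    (h1 : x + y + z = a) (h2 : x * y + x * z + y * z = b) (h3 : x * y * z = c) :
    x⁻¹ + y⁻¹ + z⁻¹ = b / c ∧ x⁻¹ * y⁻¹ + x⁻¹ * z⁻¹ + y⁻¹ * z⁻¹ = a / c ∧
      x⁻¹ * y⁻¹ * z⁻¹ = 1 / c := by
  subst h1 h2 h3
  refine ⟨?_, ?_, ?_⟩ <;> field_simp <;> ring

theorem abs_inv_mul_lt_one {x y : ℝ} (hx : 0 < x) (hxy : x < y) : |y⁻¹| * x < 1 := by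
  rw [abs_of_pos (inv_pos.2 (hx.trans hxy)), inv_mul_lt_one₀ (hx.trans hxy)]
  exact hxy

theorem norm_ofReal_lt {x y : ℝ} (hx : 0 < x) (hxy : x < y) : ‖(x : ℂ)‖ < ‖(y : ℂ)‖ := by
  rwa [Complex.norm_of_nonneg hx.le, Complex.norm_of_nonneg (hx.trans hxy).le]

/-- Three sign changes isolate the roots. The interval for `α` is narrower than its displayed digits
because these alone do not fix the fifth decimal of `(2 - α) / (1 - α)`. -/
theorem exists_roots_f2 : ∃ α β δ : ℝ, 0.162434 < α ∧ α < 0.162435 ∧ α < β ∧ β < δ ∧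
    α + β + δ = 3 ∧ α * β + α * δ + β * δ = 2 ∧ α * β * δ = 1 / 4 := by
  have hc : Continuous fun x : ℝ => f2 x := by unfold f2; fun_prop
  obtain ⟨α, ha1, ha2, ha⟩ := exists_root_of_pos_of_neg hc (a := 0.162434) (b := 0.162435)
    (by norm_num) (by norm_num [f2]) (by norm_num [f2])
  obtain ⟨β, hb1, hb2, hb⟩ := exists_root_of_neg_of_pos hc (a := 1 / 2) (b := 1)
    (by norm_num) (by norm_num [f2]) (by norm_num [f2])
  obtain ⟨δ, hd1, hd2, hd⟩ := exists_root_of_pos_of_neg hc (a := 2) (b := 3)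
    (by norm_num) (by norm_num [f2]) (by norm_num [f2])
  simp only [f2] at ha hb hd
  have hab : α < β := by norm_num at *; linarith
  have hbd : β < δ := by linarith
  exact ⟨α, β, δ, ha1, ha2, hab, hbd, vieta_cubic (by linear_combination -ha / 4)
    (by linear_combination -hb / 4) (by linear_combination -hd / 4) hab hbd⟩

theorem exists_roots_f3 : ∃ α β δ : ℝ, 0.096788 < α ∧ α < 0.096789 ∧ α < β ∧ β < δ ∧
    α + β + δ = 7 ∧ α * β + α * δ + β * δ = 11 ∧ α * β * δ = 1 := by
  have hc : Continuous fun x : ℝ => 1 - 11 * x + 7 * x ^ 2 - x ^ 3 := by fun_prop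
  obtain ⟨α, ha1, ha2, ha⟩ := exists_root_of_pos_of_neg hc (a := 0.096788) (b := 0.096789)
    (by norm_num) (by norm_num) (by norm_num)
  obtain ⟨β, hb1, hb2, hb⟩ := exists_root_of_neg_of_pos hc (a := 1) (b := 5 / 2)
    (by norm_num) (by norm_num) (by norm_num)
  obtain ⟨δ, hd1, hd2, hd⟩ := exists_root_of_pos_of_neg hc (a := 5 / 2) (b := 5)
    (by norm_num) (by norm_num) (by norm_num)
  have hab : α < β := by norm_num at *; linarith
  have hbd : β < δ := by linarith
  exact ⟨α, β, δ, ha1, ha2, hab, hbd, vieta_cubic (by linear_combination -ha)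
    (by linear_combination -hb) (by linear_combination -hd) hab hbd⟩

theorem isDominantRoot_f1 : IsDominantRoot f1 ((3 - √5) / 8 : ℝ) := by
  have h5 : √5 ^ 2 = 5 := Real.sq_sqrt (by norm_num)
  have h5C : ((√5 : ℝ) : ℂ) ^ 2 = 5 := by exact_mod_cast h5
  have hlt : √5 < 3 := by rw [Real.sqrt_lt' (by norm_num)]; norm_num
  have hpos : 0 < √5 := by positivity
  have hfac : ∀ z : ℂ, f1 z = 16 * ((z - ((3 - √5) / 8 : ℝ)) * (z - ((3 + √5) / 8 : ℝ))) := by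
    intro z
    simp only [f1]
    push_cast
    linear_combination (1 / 4) * h5C
  refine ⟨by rw [hfac]; simp, fun z hz hne => ?_⟩
  rw [hfac] at hz
  have hz' : z = ((3 + √5) / 8 : ℝ) :=
    sub_eq_zero.1 ((mul_eq_zero.1 ((mul_eq_zero.1 hz).resolve_left (by norm_num))).resolve_left
      (sub_ne_zero.2 hne))
  rw [hz']
  exact norm_ofReal_lt (by linarith) (by linarith)

theorem isDominantRoot_f2 {α β δ : ℝ} (h0 : 0 < α) (hab : α < β) (hbd : β < δ)
    (h1 : α + β + δ = 3) (h2 : α * β + α * δ + β * δ = 2) (h3 : α * β * δ = 1 / 4) :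
    IsDominantRoot f2 α := by
  have e1 : (α + β + δ : ℂ) = 3 := by exact_mod_cast h1
  have e2 : (α * β + α * δ + β * δ : ℂ) = 2 := by exact_mod_cast h2
  have e3 : (α * β * δ : ℂ) = 1 / 4 := by
    have := congrArg (fun x : ℝ => (x : ℂ)) h3
    push_cast at this
    exact this
  have hfac : ∀ z : ℂ, f2 z = -4 * ((z - α) * ((z - β) * (z - δ))) := by
    intro z
    simp only [f2]
    linear_combination -4 * z ^ 2 * e1 + 4 * z * e2 - 4 * e3
  refine ⟨by rw [hfac]; simp, fun z hz hne => ?_⟩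
  rw [hfac] at hz
  have hz' : z = β ∨ z = δ := by simpa [sub_eq_zero, hne] using hz
  rcases hz' with rfl | rfl
  · exact norm_ofReal_lt h0 hab
  · exact norm_ofReal_lt h0 (hab.trans hbd)

theorem isDominantRoot_f3 {α β δ : ℝ} (h0 : 0 < α) (h01 : α < 1) (hab : α < β) (hbd : β < δ)
    (h1 : α + β + δ = 7) (h2 : α * β + α * δ + β * δ = 11) (h3 : α * β * δ = 1) :
    IsDominantRoot f3 α := by
  have e1 : (α + β + δ : ℂ) = 7 := by exact_mod_cast h1
  have e2 : (α * β + α * δ + β * δ : ℂ) = 11 := by exact_mod_cast h2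
  have e3 : (α * β * δ : ℂ) = 1 := by exact_mod_cast h3
  have hfac : ∀ z : ℂ, f3 z = (z - (1 : ℝ)) * ((z - α) * ((z - β) * (z - δ))) := by
    intro z
    simp only [f3]
    push_cast
    linear_combination (1 - z) * (-z ^ 2 * e1 + z * e2 - e3)
  refine ⟨by rw [hfac]; simp, fun z hz hne => ?_⟩
  rw [hfac] at hz
  have hz' : z = (1 : ℝ) ∨ z = β ∨ z = δ := by simpa [sub_eq_zero, hne] using hz
  rcases hz' with rfl | rfl | rfl
  · exact norm_ofReal_lt h0 h01
  · exact norm_ofReal_lt h0 hab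
  · exact norm_ofReal_lt h0 (hab.trans hbd)

end SchroederPaths

/-! ### Assembly and numerical bounds -/

theorem mainTheorem6 :
    (∃ α₁ : ℝ, SchroederPaths.IsDominantRoot SchroederPaths.f1 α₁ ∧
      α₁ = (3 - Real.sqrt 5) / 8 ∧
      Tendsto (fun n : ℕ => ((SchroederPaths.L SchroederPaths.S4 n).ncard : ℝ) /
          ((SchroederPaths.A SchroederPaths.S4 n).ncard : ℝ)) atTop
        (𝓝 (5 * (1 - α₁) ^ 2 / (2 - 3 * α₁) ^ 2)) ∧
      5 * (1 - α₁) ^ 2 / (2 - 3 * α₁) ^ 2 ∈ Set.Ico (1.39320 : ℝ) 1.39321) ∧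
    (∃ α₂ : ℝ, SchroederPaths.IsDominantRoot SchroederPaths.f2 α₂ ∧
      α₂ ∈ Set.Ico (0.16243 : ℝ) 0.16244 ∧
      Tendsto (fun n : ℕ => ((SchroederPaths.L SchroederPaths.S5 n).ncard : ℝ) /
          ((SchroederPaths.A SchroederPaths.S5 n).ncard : ℝ)) atTop
        (𝓝 ((2 - α₂) / (1 - α₂))) ∧
      (2 - α₂) / (1 - α₂) ∈ Set.Ico (2.19393 : ℝ) 2.19394) ∧
    (∃ α₃ : ℝ, SchroederPaths.IsDominantRoot SchroederPaths.f3 α₃ ∧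
      α₃ ∈ Set.Ico (0.09678 : ℝ) 0.09679 ∧
      Tendsto (fun n : ℕ => ((SchroederPaths.L SchroederPaths.S6 n).ncard : ℝ) /
          ((SchroederPaths.A SchroederPaths.S6 n).ncard : ℝ)) atTop
        (𝓝 ((5 - α₃) / (2 - α₃) ^ 2)) ∧
      (5 - α₃) / (2 - α₃) ^ 2 ∈ Set.Ico (1.35364 : ℝ) 1.35365) := by
  open SchroederPaths in
  refine ⟨⟨(3 - √5) / 8, isDominantRoot_f1, rfl, ?_, ?_⟩, ?_, ?_⟩
  · have h5 : √5 ^ 2 = 5 := Real.sq_sqrt (by norm_num)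
    have hlt : √5 < 3 := by rw [Real.sqrt_lt' (by norm_num)]; norm_num
    have hgt : 2 < √5 := Real.lt_sqrt_of_sq_lt (by norm_num)
    have hinv : ((3 - √5) / 8)⁻¹ = 6 + 2 * √5 := by
      refine inv_eq_of_mul_eq_one_right ?_
      linear_combination (-1 / 4) * h5
    -- `γ` is the reciprocal of the other root `(3 + √5) / 8`.
    refine tendsto_S4 (γ := 6 - 2 * √5) (by linarith) (by linarith) ?_ ?_ ?_
    · rw [hinv]; ring
    · rw [hinv]; linear_combination -4 * h5
    · rw [abs_of_pos (by linarith)]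
      nlinarith
  · have h1 : 2.236067 < √5 := Real.lt_sqrt_of_sq_lt (by norm_num)
    have h2 : √5 < 2.236068 := by rw [Real.sqrt_lt' (by norm_num)]; norm_num
    norm_num at h1 h2
    have hd : 0 < (2 - 3 * ((3 - √5) / 8)) ^ 2 := by
      have : 0 < 2 - 3 * ((3 - √5) / 8) := by linarith
      positivity
    have h5 : √5 ^ 2 = 5 := Real.sq_sqrt (by norm_num)
    constructor
    · rw [le_div_iff₀ hd]
      nlinarith
    · rw [div_lt_iff₀ hd]
      nlinarith
  · obtain ⟨α, β, δ, ha1, ha2, hab, hbd, h1, h2, h3⟩ := exists_roots_f2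
    norm_num at ha1 ha2
    have h0 : 0 < α := by linarith
    obtain ⟨e1, e2, e3⟩ := inv_symmetric h0.ne' (h0.trans hab).ne'
      (h0.trans (hab.trans hbd)).ne' h1 h2 h3
    have hd : 0 < 1 - α := by linarith
    refine ⟨α, isDominantRoot_f2 h0 hab hbd h1 h2 h3, ⟨by norm_num; linarith, by norm_num; linarith⟩,
      tendsto_S5 h0 (by linarith) (by rw [e1]; norm_num) (by rw [e2]; norm_num)
        (by rw [e3]; norm_num) (abs_inv_mul_lt_one h0 hab)
        (abs_inv_mul_lt_one h0 (hab.trans hbd)), ?_, ?_⟩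
    · rw [le_div_iff₀ hd]; linarith
    · rw [div_lt_iff₀ hd]; linarith
  · obtain ⟨α, β, δ, ha1, ha2, hab, hbd, h1, h2, h3⟩ := exists_roots_f3
    norm_num at ha1 ha2
    have h0 : 0 < α := by linarith
    have h01 : α < 1 := by linarith
    obtain ⟨e1, e2, e3⟩ := inv_symmetric h0.ne' (h0.trans hab).ne'
      (h0.trans (hab.trans hbd)).ne' h1 h2 h3
    have hd : 0 < (2 - α) ^ 2 := by
      have : 0 < 2 - α := by linarith
      positivity
    refine ⟨α, isDominantRoot_f3 h0 h01 hab hbd h1 h2 h3,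
      ⟨by norm_num; linarith, by norm_num; linarith⟩,
      tendsto_S6 h0 h01 (by rw [e1]; norm_num) (by rw [e2]; norm_num)
        (by rw [e3]; norm_num) (abs_inv_mul_lt_one h0 hab)
        (abs_inv_mul_lt_one h0 (hab.trans hbd)), ?_, ?_⟩
    · rw [le_div_iff₀ hd]; nlinarith
    -- The bounds `ha1` and `ha2` alone are not enough: at `α = 0.096789` the quotient exceeds
    -- 1.35365. The relations among the three roots confine `α` further.
    · rw [div_lt_iff₀ hd]; nlinarith
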